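/- For $n \in \mathbb{Z}_{\ge 0}$ let $M(n)$ denote the $n$-th Motzkin number, that is, the number of lattice paths from $(0,0)$ to $(n,0)$ with steps $(1,1)$, $(1,0)$, $(1,-1)$ that never go below the horizontal axis. Let $p \in \{5, 13, 31, 37, 61, 79, 97, 103\}$. Then $M(n) \not\equiv 0 \pmod{p^2}$ for all $n \in \mathbb{Z}_{\ge 0}$. For any other prime $p < 200$, there exists $n \in \mathbb{Z}_{\ge 0}$ such that $p^2$ divides $M(n)$. -/

import Mathlib

/-- A step sequence of length `n` with vertical steps in `{-1, 0, 1}` (down, level, up) is a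
Motzkin path if, starting at height `0`, it never goes below height `0` and ends at height `0`. -/
def IsMotzkinPath {n : ℕ} (s : Fin n → SignType) : Prop :=
  (∀ k ≤ n, 0 ≤ ∑ i : Fin n with i.val < k, (s i : ℤ)) ∧ ∑ i : Fin n, (s i : ℤ) = 0

/-- The `n`-th Motzkin number: the number of Motzkin paths of length `n`. -/
noncomputable def motzkin (n : ℕ) : ℕ :=
  Nat.card {s : Fin n → SignType // IsMotzkinPath s}

/-! Let T(n) be the central trinomial coefficient and M(n) the Motzkin number. Reflection gives
2(n+2)M(n) = 3T(n) + T(n+1), so p² ∣ M(n) becomes a question about T modulo p². If T(p) ≡ 1 mod p²,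
then T(pm) ≡ T(m), and the three-term recurrence carries this to T(pm+s) for s < p: up to a unit it
is a₀T(m) + pm(a₁T(m) + a₂T(m-1)) (`get_spec`). If p divides no T(s), the Lucas congruence reduces
the vanishing of such a form to m < p (`trinomialForm_ne_zero`). This settles all indices except n ≡
-1, -2 mod p. There T(pn-1) ≡ ελⁿT(n-1) turns the question into the vanishing of vλⁿT(n-1) + T(n).
When p ∣ n this form reproduces itself at n/p with v replaced by εv, so descent ends at p ∤ n, again
a finite check (`boundary_ne_zero`). The hypothesis T(p) ≡ 1 and the congruence for T(pn-1) are
verified by computation for each prime, as are the nonvanishing conditions or, for the other primes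
above 3, an explicit zero. -/

/-! ### Trinomial coefficients and their recurrence -/

/-- The trinomial coefficient: the number of paths of length `n` with steps in `{-1, 0, 1}` from
height `0` to height `j`, that is, the coefficient of `x ^ j` in `(x⁻¹ + 1 + x) ^ n`. -/
def trinomialCoeff : ℕ → ℤ → ℕ
  | 0, j => if j = 0 then 1 else 0
  | n + 1, j => trinomialCoeff n (j - 1) + trinomialCoeff n j + trinomialCoeff n (j + 1)

theorem trinomialCoeff_succ (n : ℕ) (j : ℤ) :
    trinomialCoeff (n + 1) j = trinomialCoeff n (j - 1) + trinomialCoeff n j + trinomialCoeff n (j + 1) := rfl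

theorem trinomialCoeff_neg (n : ℕ) (j : ℤ) : trinomialCoeff n (-j) = trinomialCoeff n j := by
  induction n generalizing j with
  | zero => simp [trinomialCoeff]
  | succ n ih =>
    rw [trinomialCoeff_succ, trinomialCoeff_succ, ih, ← ih (j - 1), ← ih (j + 1),
      show -(j - 1) = -j + 1 by ring, show -(j + 1) = -j - 1 by ring]
    ring

/-- With P = x⁻¹ + 1 + x and θ = x d/dx, this compares coefficients of xʲ in P·θ(Pⁿ) = n·θ(P)·Pⁿ. -/
theorem trinomialCoeff_horizontal (n : ℕ) (j : ℤ) :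
    (n + 1 + j : ℤ) * trinomialCoeff n (j + 1) + j * trinomialCoeff n j
      = (n + 1 - j) * trinomialCoeff n (j - 1) := by
  induction n generalizing j with
  | zero =>
    by_cases h0 : j = 0
    · subst h0; simp [trinomialCoeff]
    by_cases h1 : j = 1
    · subst h1; simp [trinomialCoeff]
    by_cases h2 : j = -1
    · subst h2; simp [trinomialCoeff]
    simp [trinomialCoeff, h0, show j + 1 ≠ 0 by omega, show j - 1 ≠ 0 by omega]
  | succ n ih =>
    have h1 := ih (j - 1)
    have h2 := ih j
    have h3 := ih (j + 1)
    simp only [trinomialCoeff_succ]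
    simp only [add_sub_cancel_right, sub_add_cancel] at *
    push_cast
    linear_combination h1 + h2 + h3

/-- The central trinomial coefficient. -/
def centralTrinomial (n : ℕ) : ℕ := trinomialCoeff n 0

theorem two_mul_trinomialCoeff_one (n : ℕ) :
    2 * (trinomialCoeff n 1 : ℤ) = centralTrinomial (n + 1) - centralTrinomial n := by
  have h := trinomialCoeff_neg n 1
  simp only [centralTrinomial, trinomialCoeff_succ, zero_sub, zero_add, h]
  push_cast; ring

theorem trinomialCoeff_two (n : ℕ) :
    (n + 2 : ℤ) * trinomialCoeff n 2 + trinomialCoeff n 1 = n * trinomialCoeff n 0 := by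
  have h := trinomialCoeff_horizontal n 1
  norm_num at h
  linear_combination h

theorem centralTrinomial_succ_succ (n : ℕ) :
    (centralTrinomial (n + 2) : ℤ)
      = centralTrinomial n + 2 * centralTrinomial (n + 1) + 2 * trinomialCoeff n 2 := by
  have h1 := two_mul_trinomialCoeff_one n
  have h2 := two_mul_trinomialCoeff_one (n + 1)
  have h3 := trinomialCoeff_succ n 1
  have h4 : trinomialCoeff n 0 = centralTrinomial n := rfl
  norm_num at h3
  zify at h3 h4
  linear_combination -h2 + 2 * h3 + h1 + 2 * h4

theorem centralTrinomial_rec (n : ℕ) :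
    (n + 1) * centralTrinomial (n + 1)
      = (2 * n + 1) * centralTrinomial n + 3 * n * centralTrinomial (n - 1) := by
  cases n with
  | zero => decide
  | succ n =>
    have h1 := two_mul_trinomialCoeff_one n
    have h2 := trinomialCoeff_two n
    have h3 := centralTrinomial_succ_succ n
    have h4 : trinomialCoeff n 0 = centralTrinomial n := rfl
    rw [h4] at h2
    zify
    simp only [Nat.add_sub_cancel]
    linear_combination (n + 2 : ℤ) * h3 + 2 * h2 - h1

/-! ### Motzkin numbers in terms of central trinomial coefficients -/

/-- The number of sequences of `n` steps in `{-1, 0, 1}` that start at height `0`, never go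
below height `0` and end at height `h`. -/
noncomputable def nonnegPathCount (n : ℕ) (h : ℤ) : ℕ :=
  Nat.card {s : Fin n → SignType //
    (∀ k ≤ n, 0 ≤ ∑ i : Fin n with i.val < k, (s i : ℤ)) ∧ ∑ i : Fin n, (s i : ℤ) = h}

theorem sum_filter_snoc (n k : ℕ) (hk : k ≤ n) (s : Fin n → SignType) (x : SignType) :
    ∑ i : Fin (n + 1) with i.val < k, ((Fin.snoc s x : Fin (n + 1) → SignType) i : ℤ)
      = ∑ i : Fin n with i.val < k, (s i : ℤ) := by
  simp only [Finset.sum_filter, Fin.sum_univ_castSucc, Fin.val_castSucc, Fin.val_last,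
    Fin.snoc_castSucc]
  rw [if_neg (by omega), add_zero]

theorem sum_filter_val_lt (n k : ℕ) (hk : n ≤ k) (s : Fin n → SignType) :
    ∑ i : Fin n with i.val < k, (s i : ℤ) = ∑ i : Fin n, (s i : ℤ) := by
  rw [Finset.filter_true_of_mem]
  intro i _
  omega

theorem nonnegPathCount_of_neg (n : ℕ) (h : ℤ) (hh : h < 0) : nonnegPathCount n h = 0 := by
  rw [nonnegPathCount, Nat.card_eq_zero]
  left
  constructor
  rintro ⟨s, h1, h2⟩
  have := h1 n le_rfl
  rw [sum_filter_val_lt n n le_rfl, h2] at this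
  omega

/-- Removing the last step of a nonnegative path. -/
def nonnegPathEquiv (n : ℕ) (h : ℤ) (hh : 0 ≤ h) :
    {s : Fin (n + 1) → SignType //
      (∀ k ≤ n + 1, 0 ≤ ∑ i : Fin (n + 1) with i.val < k, (s i : ℤ)) ∧
        ∑ i : Fin (n + 1), (s i : ℤ) = h} ≃
    (x : SignType) × {s : Fin n → SignType //
      (∀ k ≤ n, 0 ≤ ∑ i : Fin n with i.val < k, (s i : ℤ)) ∧
        ∑ i : Fin n, (s i : ℤ) = h - (x : ℤ)} where
  toFun s := ⟨s.1 (Fin.last n), Fin.init s.1, by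
    obtain ⟨s, h1, h2⟩ := s
    constructor
    · intro k hk
      have := h1 k (by omega)
      rw [← Fin.snoc_init_self s, sum_filter_snoc n k hk] at this
      exact this
    · rw [Fin.sum_univ_castSucc] at h2
      simp only [Fin.init]
      linarith⟩
  invFun y := ⟨Fin.snoc y.2.1 y.1, by
    obtain ⟨x, s, h1, h2⟩ := y
    have h3 : ∑ i : Fin (n + 1), ((Fin.snoc s x : Fin (n + 1) → SignType) i : ℤ) = h := by
      rw [Fin.sum_univ_castSucc]
      simp only [Fin.snoc_castSucc, Fin.snoc_last]
      linarith
    refine ⟨fun k hk => ?_, h3⟩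
    rcases Nat.lt_or_ge n k with hlt | hle
    · rw [sum_filter_val_lt (n + 1) k hlt, h3]
      exact hh
    · rw [sum_filter_snoc n k hle]
      exact h1 k hle⟩
  left_inv s := by simp
  right_inv y := by
    obtain ⟨x, s, hs⟩ := y
    exact Sigma.subtype_ext (by simp) (by simp)

theorem nonnegPathCount_succ (n : ℕ) (h : ℤ) (hh : 0 ≤ h) :
    nonnegPathCount (n + 1) h
      = nonnegPathCount n (h - 1) + nonnegPathCount n h + nonnegPathCount n (h + 1) := by
  rw [nonnegPathCount, Nat.card_congr (nonnegPathEquiv n h hh), Nat.card_sigma]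
  have : (Finset.univ : Finset SignType) = {0, -1, 1} := by decide
  rw [this, Finset.sum_insert (by decide), Finset.sum_insert (by decide), Finset.sum_singleton]
  simp only [nonnegPathCount, SignType.coe_zero, SignType.coe_one, SignType.coe_neg_one, sub_zero,
    sub_neg_eq_add]
  ring

/-- The reflection principle. -/
theorem nonnegPathCount_add_trinomialCoeff (n : ℕ) (h : ℤ) (hh : -1 ≤ h) :
    nonnegPathCount n h + trinomialCoeff n (h + 2) = trinomialCoeff n h := by
  induction n generalizing h with
  | zero =>
    rcases eq_or_lt_of_le hh with rfl | h1
    · rw [nonnegPathCount_of_neg 0 _ (by norm_num)]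
      simp [trinomialCoeff]
    · have h3 : h + 2 ≠ 0 := by omega
      by_cases h0 : h = 0
      · subst h0
        simp [nonnegPathCount, trinomialCoeff]
      · simp [nonnegPathCount, trinomialCoeff, h0, h3, Ne.symm h0]
  | succ n ih =>
    rcases eq_or_lt_of_le hh with rfl | h1
    · rw [nonnegPathCount_of_neg _ _ (by norm_num), ← trinomialCoeff_neg (n + 1) (-1)]
      norm_num
    · rw [nonnegPathCount_succ n h (by omega), trinomialCoeff_succ, trinomialCoeff_succ]
      have e1 := ih (h - 1) (by omega)
      have e2 := ih h (by omega)
      have e3 := ih (h + 1) (by omega)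
      rw [show h - 1 + 2 = h + 2 - 1 by ring] at e1
      rw [show h + 1 + 2 = h + 2 + 1 by ring] at e3
      omega

theorem motzkin_add_trinomialCoeff_two (n : ℕ) :
    motzkin n + trinomialCoeff n 2 = centralTrinomial n :=
  nonnegPathCount_add_trinomialCoeff n 0 (by norm_num)

theorem two_mul_add_two_mul_motzkin (n : ℕ) :
    2 * (n + 2) * motzkin n = 3 * centralTrinomial n + centralTrinomial (n + 1) := by
  have h1 := motzkin_add_trinomialCoeff_two n
  have h2 := trinomialCoeff_two n
  have h3 := two_mul_trinomialCoeff_one n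
  have h4 : trinomialCoeff n 0 = centralTrinomial n := rfl
  rw [h4] at h2
  zify at h1 ⊢
  linear_combination 2 * (n + 2 : ℤ) * h1 - 2 * h2 + h3

/-- The factor n + 2 is absent here, so this form remains usable when p ∣ n + 2. -/
theorem two_mul_motzkin (n : ℕ) :
    2 * motzkin n + centralTrinomial (n + 2)
      = 3 * centralTrinomial n + 2 * centralTrinomial (n + 1) := by
  have h1 := motzkin_add_trinomialCoeff_two n
  have h2 := centralTrinomial_succ_succ n
  zify at h1 ⊢
  linear_combination 2 * h1 + h2

/-! ### Congruences modulo p and p² from the generating polynomial -/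

theorem trinomialCoeff_eq_zero_of_lt_neg (n : ℕ) (j : ℤ) (h : j < -n) :
    trinomialCoeff n j = 0 := by
  induction n generalizing j with
  | zero => simp only [trinomialCoeff]; push_cast at h; rw [if_neg (by omega)]
  | succ n ih =>
    push_cast at h
    rw [trinomialCoeff_succ, ih _ (by omega), ih _ (by omega), ih _ (by omega)]

theorem trinomialCoeff_eq_zero_of_lt (n : ℕ) (j : ℤ) (h : (n : ℤ) < j) :
    trinomialCoeff n j = 0 := by
  rw [← trinomialCoeff_neg]
  exact trinomialCoeff_eq_zero_of_lt_neg n (-j) (by omega)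

theorem trinomialCoeff_self (n : ℕ) : trinomialCoeff n n = 1 := by
  induction n with
  | zero => rfl
  | succ n ih =>
    push_cast
    rw [trinomialCoeff_succ, trinomialCoeff_eq_zero_of_lt n (n + 1) (by omega),
      trinomialCoeff_eq_zero_of_lt n (n + 1 + 1) (by omega), add_sub_cancel_right, ih]

open Polynomial

/-- The polynomial whose powers generate the trinomial coefficients. -/
noncomputable def trinomialPoly (R : Type*) [CommRing R] : R[X] := 1 + X + X ^ 2

theorem map_trinomialPoly {R S : Type*} [CommRing R] [CommRing S] (f : R →+* S) :
    (trinomialPoly R).map f = trinomialPoly S := by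
  simp [trinomialPoly]

theorem coeff_trinomialPoly_pow (R : Type*) [CommRing R] (n k : ℕ) :
    (trinomialPoly R ^ n).coeff k = (trinomialCoeff n ((k : ℤ) - n) : R) := by
  induction n generalizing k with
  | zero => by_cases h : k = 0 <;> simp [trinomialCoeff, coeff_one, h]
  | succ n ih =>
    rw [pow_succ, trinomialPoly, mul_add, mul_add, mul_one, coeff_add, coeff_add, ← trinomialPoly,
      trinomialCoeff_succ, show (k : ℤ) - ((n + 1 : ℕ) : ℤ) - 1 = k - 2 - n by push_cast; ring,
      show (k : ℤ) - ((n + 1 : ℕ) : ℤ) + 1 = k - n by push_cast; ring,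
      show (k : ℤ) - ((n + 1 : ℕ) : ℤ) = k - 1 - n by push_cast; ring, coeff_mul_X_pow', ih]
    rcases k with _ | _ | k
    · rw [mul_coeff_zero, trinomialCoeff_eq_zero_of_lt_neg n (_ - 2 - _) (by push_cast; omega),
        trinomialCoeff_eq_zero_of_lt_neg n (_ - 1 - _) (by push_cast; omega)]
      simp
    · rw [coeff_mul_X, ih, trinomialCoeff_eq_zero_of_lt_neg n (_ - 2 - _) (by push_cast; omega)]
      simp [add_comm]
    · rw [coeff_mul_X, ih, if_pos (by omega), ih, show k + 1 + 1 - 2 = k by omega,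
        show ((k + 1 + 1 : ℕ) : ℤ) - 2 - n = k - n by push_cast; ring,
        show ((k + 1 + 1 : ℕ) : ℤ) - 1 - n = (k + 1 : ℕ) - n by push_cast; ring]
      push_cast
      ring

theorem coeff_trinomialPoly_pow_self (R : Type*) [CommRing R] (n : ℕ) :
    (trinomialPoly R ^ n).coeff n = (centralTrinomial n : R) := by
  rw [coeff_trinomialPoly_pow, sub_self]; rfl

/-- Only the terms of f with exponent divisible by p meet the exponents of g(xᵖ) in a multiple of p,
and among them only xᵖ survives. -/
theorem coeff_mul_expand_of_contract {R : Type*} [CommRing R] {p : ℕ} (hp : p ≠ 0)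
    {f : R[X]} (hf : ∀ j ≠ 1, f.coeff (j * p) = 0) (g : R[X]) (m : ℕ) :
    (f * expand R p g).coeff ((m + 1) * p) = f.coeff p * g.coeff m := by
  have h : contract p f = C (f.coeff p) * X := by
    ext j
    rw [coeff_contract hp, coeff_C_mul, coeff_X]
    by_cases hj : j = 1
    · simp [hj]
    · rw [hf j hj, if_neg (Ne.symm hj), mul_zero]
  rw [← coeff_contract hp, contract_mul_expand hp, h, mul_assoc, coeff_C_mul, coeff_X_mul]

/-- The Lucas congruence for central trinomial coefficients. -/
theorem centralTrinomial_lucas (p : ℕ) [Fact p.Prime] (m s : ℕ) (hs : s < p) :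
    (centralTrinomial (p * m + s) : ZMod p) = centralTrinomial m * centralTrinomial s := by
  have hp : p ≠ 0 := (Fact.out : p.Prime).ne_zero
  -- Shifting by p - s moves the central term to xᵖ; the exponents then lie in [p-s, p+s], where p
  -- is the only multiple of p.
  have hf : ∀ j ≠ 1, (trinomialPoly (ZMod p) ^ s * X ^ (p - s)).coeff (j * p) = 0 := by
    intro j hj
    rw [coeff_mul_X_pow']
    rcases j with _ | _ | j
    · rw [if_neg (by omega)]
    · exact absurd rfl hj
    · have h1 : (j + 1 + 1) * p = j * p + p + p := by ring
      rw [if_pos (by omega), coeff_trinomialPoly_pow,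
        trinomialCoeff_eq_zero_of_lt _ _ (by rw [h1]; omega),
        Nat.cast_zero]
  have h := coeff_mul_expand_of_contract hp hf (trinomialPoly (ZMod p) ^ m) m
  rw [map_pow, ZMod.expand_card, coeff_mul_X_pow', if_pos (by omega), Nat.sub_sub_self hs.le,
    coeff_trinomialPoly_pow_self, coeff_trinomialPoly_pow_self, mul_right_comm, ← pow_mul,
    ← pow_add, coeff_mul_X_pow'] at h
  have h1 : (m + 1) * p = p * m + p := by ring
  rw [if_pos (by rw [h1]; omega), h1, show p * m + p - (p - s) = s + p * m by omega,
    coeff_trinomialPoly_pow_self] at h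
  rw [add_comm, h, mul_comm]

/-- Write F(x)ᵖ = F(xᵖ) + E with p ∣ E. Modulo p² the m-th power is F(xᵖ)ᵐ + mF(xᵖ)ᵐ⁻¹E, and the
central coefficient is read off. -/
theorem centralTrinomial_mul_modEq (p : ℕ) [Fact p.Prime] (m : ℕ) :
    (p ^ 2 : ℤ) ∣ centralTrinomial (p * m)
      - m * ((centralTrinomial p - 1) * centralTrinomial (m - 1)) - centralTrinomial m := by
  have hp : p ≠ 0 := (Fact.out : p.Prime).ne_zero
  have hp0 : 0 < p := Nat.pos_of_ne_zero hp
  set F := trinomialPoly ℤ with hF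
  set E := F ^ p - expand ℤ p F with hE
  have hdvd : C (p : ℤ) ∣ E := by
    rw [C_dvd_iff_dvd_coeff]
    intro i
    rw [← ZMod.intCast_zmod_eq_zero_iff_dvd, ← eq_intCast (Int.castRingHom (ZMod p)), ← coeff_map, hE,
      Polynomial.map_sub, Polynomial.map_pow, map_expand, map_trinomialPoly, ZMod.expand_card,
      sub_self, coeff_zero]
  have hcF : ∀ j, F.coeff j = if j ≤ 2 then 1 else 0 := by
    intro j
    rw [hF, trinomialPoly]
    rcases j with _ | _ | _ | j <;> simp [coeff_one, coeff_X, coeff_X_pow]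
  -- The end coefficients at x⁰ and x²ᵖ are 1 in both Fᵖ and F(xᵖ), so they cancel.
  have hc : ∀ j ≠ 1, E.coeff (j * p) = 0 := by
    intro j hj
    rw [hE, coeff_sub, coeff_expand_mul hp0, coeff_trinomialPoly_pow, hcF]
    rcases j with _ | _ | _ | j
    · rw [zero_mul, Nat.cast_zero, zero_sub, trinomialCoeff_neg, trinomialCoeff_self]; simp
    · exact absurd rfl hj
    · rw [show ((((0 + 1 + 1) * p : ℕ) : ℤ) - p) = p by push_cast; ring, trinomialCoeff_self]; simp
    · rw [trinomialCoeff_eq_zero_of_lt, if_neg (by omega)]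
      · simp
      · push_cast; nlinarith
  have hc1 : E.coeff p = centralTrinomial p - 1 := by
    have := coeff_expand_mul hp0 F 1
    rw [one_mul] at this
    rw [hE, coeff_sub, this, coeff_trinomialPoly_pow_self, hcF]
    simp
  have h := (pow_dvd_pow_of_dvd hdvd 2).trans (sq_dvd_add_pow_sub_sub E (expand ℤ p F) m)
  rw [show expand ℤ p F + E = F ^ p by rw [hE]; ring, ← C_pow, C_dvd_iff_dvd_coeff] at h
  have h := h (m * p)
  rw [coeff_sub, coeff_sub, ← pow_mul, ← map_pow (expand ℤ p),
    ← map_pow (expand ℤ p), coeff_expand_mul hp0, mul_comm m p,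
    coeff_trinomialPoly_pow_self, coeff_trinomialPoly_pow_self, coeff_mul_natCast] at h
  rcases m with _ | m
  · simp
  · rw [mul_comm (expand ℤ p _), mul_comm p, Nat.add_sub_cancel,
      coeff_mul_expand_of_contract hp hc, hc1,
      coeff_trinomialPoly_pow_self, mul_comm _ p] at h
    rw [Nat.add_sub_cancel, mul_comm (((m + 1 : ℕ) : ℤ))]
    exact h

theorem centralTrinomial_mul (p : ℕ) [Fact p.Prime]
    (h : (centralTrinomial p : ZMod (p ^ 2)) = 1) (m : ℕ) :
    (centralTrinomial (p * m) : ZMod (p ^ 2)) = centralTrinomial m := by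
  have h1 := centralTrinomial_mul_modEq p m
  have h2 := (ZMod.intCast_zmod_eq_zero_iff_dvd
    (centralTrinomial (p * m) - m * ((centralTrinomial p - 1) * centralTrinomial (m - 1))
      - centralTrinomial m) (p ^ 2)).mpr (by exact_mod_cast h1)
  push_cast at h2
  rw [h, sub_self, zero_mul, mul_zero, sub_zero] at h2
  exact sub_eq_zero.mp h2

/-! ### Nonvanishing of linear forms modulo p² -/

theorem natCast_mul_eq_natCast_mul {p a b : ℕ} (h : (a : ZMod p) = b) :
    (p : ZMod (p ^ 2)) * a = p * b := by
  have h1 := (ZMod.natCast_eq_natCast_iff a b p).mp h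
  have h2 := (ZMod.natCast_eq_natCast_iff (p * a) (p * b) (p ^ 2)).mpr
    (by rw [sq]; exact h1.mul_left' p)
  push_cast at h2
  exact h2

theorem natCast_mul_self_eq_zero (p : ℕ) : (p : ZMod (p ^ 2)) * p = 0 := by
  have := ZMod.natCast_self (p ^ 2)
  push_cast at this
  rw [← sq, this]

theorem isUnit_natCast_of_not_dvd {p : ℕ} (hp : p.Prime) {a : ℕ} (h : ¬ p ∣ a) :
    IsUnit (a : ZMod (p ^ 2)) := by
  rw [ZMod.isUnit_iff_coprime]
  exact Nat.Coprime.pow_right 2 ((Nat.Prime.coprime_iff_not_dvd hp).mpr h).symm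

theorem natCast_mul_centralTrinomial (p : ℕ) [Fact p.Prime] (m s : ℕ) (hs : s < p) :
    (p : ZMod (p ^ 2)) * centralTrinomial (p * m + s)
      = p * (centralTrinomial m * centralTrinomial s) := by
  have := natCast_mul_eq_natCast_mul (p := p) (a := centralTrinomial (p * m + s))
    (b := centralTrinomial m * centralTrinomial s)
    (by push_cast; exact centralTrinomial_lucas p m s hs)
  push_cast at this
  exact this

theorem not_dvd_centralTrinomial (p : ℕ) [Fact p.Prime]
    (h : ∀ s < p, ¬ p ∣ centralTrinomial s) (n : ℕ) : ¬ p ∣ centralTrinomial n := by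
  have hp : p.Prime := Fact.out
  induction n using Nat.strong_induction_on with
  | _ n ih =>
    rcases Nat.lt_or_ge n p with hn | hn
    · exact h n hn
    · have h1 := centralTrinomial_lucas p (n / p) (n % p) (Nat.mod_lt n hp.pos)
      rw [Nat.div_add_mod, ← Nat.cast_mul, ZMod.natCast_eq_natCast_iff] at h1
      intro hd
      rcases hp.dvd_mul.mp ((h1.dvd_iff dvd_rfl).mp hd) with h2 | h2
      · exact ih _ (Nat.div_lt_self (hp.pos.trans_le hn) hp.one_lt) h2
      · exact h _ (Nat.mod_lt n hp.pos) h2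

/-- The pair of central trinomial coefficients with indices `n` and `n - 1`, computed by the
three-term recurrence. -/
def trinomialPair : ℕ → ℕ × ℕ
  | 0 => (1, 1)
  | n + 1 =>
    (((2 * n + 1) * (trinomialPair n).1 + 3 * n * (trinomialPair n).2) / (n + 1),
      (trinomialPair n).1)

theorem trinomialPair_eq (n : ℕ) :
    trinomialPair n = (centralTrinomial n, centralTrinomial (n - 1)) := by
  induction n with
  | zero => rfl
  | succ n ih =>
    rw [trinomialPair, ih, Nat.add_sub_cancel]
    simp only
    rw [← centralTrinomial_rec, Nat.mul_div_cancel_left _ (Nat.succ_pos n)]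

/-- The linear form `i * T m + p * m * (j * T m + k * T (m - 1))` in the central trinomial
coefficients `T m` and `T (m - 1)`. -/
def trinomialForm (p m i j k : ℕ) : ℕ :=
  i * (trinomialPair m).1 + p * m * (j * (trinomialPair m).1 + k * (trinomialPair m).2)

theorem natCast_trinomialForm (p m i j k : ℕ) :
    (trinomialForm p m i j k : ZMod (p ^ 2)) = i * centralTrinomial m
      + p * m * (j * centralTrinomial m + k * centralTrinomial (m - 1)) := by
  rw [trinomialForm, trinomialPair_eq]
  push_cast
  rfl

/-- Modulo p the form is i·T(m) with p ∤ T(m), so a zero forces p ∣ i. The whole form is then p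
times a quantity needed only modulo p, and by Lucas that quantity is T(m / p) times its value at m %
p. -/
theorem trinomialForm_ne_zero (p : ℕ) [Fact p.Prime]
    (hT : ∀ s < p, ¬ p ∣ centralTrinomial s) (i j k : ℕ)
    (h : p ∣ i → ∀ t < p, (trinomialForm p t i j k : ZMod (p ^ 2)) ≠ 0) (m : ℕ) :
    (trinomialForm p m i j k : ZMod (p ^ 2)) ≠ 0 := by
  have hp : p.Prime := Fact.out
  have hpp := natCast_mul_self_eq_zero p
  intro h0
  have hi : p ∣ i := by
    rw [natCast_trinomialForm] at h0
    have h1 : ((p * (i * centralTrinomial m) : ℕ) : ZMod (p ^ 2)) = 0 := by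
      push_cast
      linear_combination (p : ZMod (p ^ 2)) * h0 - (m * (j * centralTrinomial m
        + k * centralTrinomial (m - 1)) : ZMod (p ^ 2)) * hpp
    rw [ZMod.natCast_eq_zero_iff, sq] at h1
    have h2 := Nat.dvd_of_mul_dvd_mul_left hp.pos h1
    exact (hp.dvd_mul.mp h2).resolve_right (not_dvd_centralTrinomial p hT m)
  have ht := Nat.mod_lt m hp.pos
  have h1 := h hi (m % p) ht
  obtain ⟨i, rfl⟩ := hi
  have hu := isUnit_natCast_of_not_dvd hp (not_dvd_centralTrinomial p hT (m / p))
  apply h1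
  rw [← hu.mul_right_eq_zero]
  rw [natCast_trinomialForm] at h0 ⊢
  have hm := Nat.div_add_mod m p
  set t := m % p with htdef
  set l := m / p with hl
  have e1 := natCast_mul_centralTrinomial p l t ht
  rw [hm] at e1
  have e2 : (p : ZMod (p ^ 2)) * m = p * t := by
    rw [← hm]; push_cast; linear_combination (l : ZMod (p ^ 2)) * hpp
  -- At t = 0 the index t - 1 truncates and Lucas does not apply, but the factor t kills both sides.
  have e3 : (p : ZMod (p ^ 2)) * t * centralTrinomial (m - 1)
      = p * t * (centralTrinomial l * centralTrinomial (t - 1)) := by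
    rcases Nat.eq_zero_or_pos t with h2 | h2
    · rw [h2]; simp
    · have := natCast_mul_centralTrinomial p l (t - 1) (by omega)
      rw [← Nat.add_sub_assoc h2, hm] at this
      linear_combination (t : ZMod (p ^ 2)) * this
  push_cast at h0 ⊢
  linear_combination h0 - (i + t * j : ZMod (p ^ 2)) * e1 - k * e3
    - (j * centralTrinomial m + k * centralTrinomial (m - 1) : ZMod (p ^ 2)) * e2

/-! ### The recurrence modulo p² along pm + s -/

/-- Coefficients describing `T (p * m + s)` and `T (p * m + s - 1)`, up to a common unit, as
linear forms in `T m` and `T (m - 1)` modulo `p ^ 2`; the unit is `d₀ + p * m * d₁`. -/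
structure TrinomialState where
  (a₀ a₁ a₂ b₀ b₁ b₂ d₀ d₁ : ℕ)

namespace TrinomialState

/-- The effect of the recurrence of the central trinomial coefficients. -/
def step (q s : ℕ) (x : TrinomialState) : TrinomialState where
  a₀ := ((2 * s + 1) * x.a₀ + 3 * x.b₀) % q
  a₁ := (2 * x.a₀ + (2 * s + 1) * x.a₁ + 3 * x.b₁) % q
  a₂ := ((2 * s + 1) * x.a₂ + 3 * x.b₂) % q
  b₀ := (s + 1) ^ 2 * x.a₀ % q
  b₁ := ((s + 1) ^ 2 * x.a₁ + 2 * (s + 1) * x.a₀) % q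
  b₂ := (s + 1) ^ 2 * x.a₂ % q
  d₀ := (s + 1) * x.d₀ % q
  d₁ := ((s + 1) * x.d₁ + x.d₀) % q

/-- The state describing the index `p * m + s`. -/
def get (p : ℕ) : ℕ → TrinomialState
  | 0 => ⟨1, 0, 0, 0, 0, (trinomialPair p).2, 1, 0⟩
  | s + 1 => (get p s).step (p ^ 2) s

/-- The unit `(p * m + 1) * ⋯ * (p * m + s)`. -/
def unit (p m s : ℕ) : ℕ := ∏ i ∈ Finset.range s, (p * m + i + 1)

theorem isUnit_unit (p : ℕ) (hp : p.Prime) (m s : ℕ) (hs : s < p) :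
    IsUnit (unit p m s : ZMod (p ^ 2)) := by
  apply isUnit_natCast_of_not_dvd hp
  rw [unit, (Nat.prime_iff.mp hp).dvd_finsetProd_iff]
  rintro ⟨i, hi, hd⟩
  rw [add_assoc, ← Nat.dvd_add_iff_right (Dvd.intro _ rfl)] at hd
  have := Nat.le_of_dvd (Nat.succ_pos i) hd
  have := Finset.mem_range.mp hi
  omega

theorem unit_succ (p m s : ℕ) : unit p m (s + 1) = unit p m s * (p * m + s + 1) :=
  Finset.prod_range_succ _ _

/-- The third identity keeps the factor pm + s because T(pm-1) is known only modulo p at the start: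
by Lucas, pm·T(pm-1) ≡ pm·T(p-1)T(m-1), whence the initial b₂. -/
theorem get_spec (p : ℕ) [Fact p.Prime] (h : (centralTrinomial p : ZMod (p ^ 2)) = 1)
    (m s : ℕ) :
    ((unit p m s : ZMod (p ^ 2)) = (get p s).d₀ + p * m * (get p s).d₁) ∧
    (unit p m s * centralTrinomial (p * m + s) : ZMod (p ^ 2)) =
      trinomialForm p m (get p s).a₀ (get p s).a₁ (get p s).a₂ ∧
    ((p * m + s : ZMod (p ^ 2)) * unit p m s * centralTrinomial (p * m + s - 1)) =
      trinomialForm p m (get p s).b₀ (get p s).b₁ (get p s).b₂ := by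
  have hp : p.Prime := Fact.out
  have hpp := natCast_mul_self_eq_zero p
  induction s with
  | zero =>
    refine ⟨by simp [unit, get], ?_, ?_⟩
    · simp [unit, get, natCast_trinomialForm, centralTrinomial_mul p h]
    · simp only [unit, get, natCast_trinomialForm, trinomialPair_eq, Finset.range_zero,
        Finset.prod_empty]
      rcases m with _ | m
      · simp
      · have := natCast_mul_centralTrinomial p m (p - 1) (by have := hp.pos; omega)
        rw [show p * m + (p - 1) = p * (m + 1) + 0 - 1 by
          rw [mul_add]; have := hp.pos; omega] at this
        push_cast
        linear_combination (m + 1 : ZMod (p ^ 2)) * this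
  | succ s ih =>
    obtain ⟨h1, h2, h3⟩ := ih
    have hr := congrArg (Nat.cast : ℕ → ZMod (p ^ 2)) (centralTrinomial_rec (p * m + s))
    simp only [natCast_trinomialForm] at h2 h3
    simp only [natCast_trinomialForm, unit_succ, get, step, ZMod.natCast_mod, ← add_assoc,
      Nat.add_sub_cancel]
    push_cast at hr ⊢
    refine ⟨?_, ?_, ?_⟩
    · rw [h1]
      linear_combination (m ^ 2 * (get p s).d₁ : ZMod (p ^ 2)) * hpp
    · linear_combination (unit p m s : ZMod (p ^ 2)) * hr + (2 * (p * m + s) + 1) * h2 + 3 * h3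
        + (2 * m ^ 2 * ((get p s).a₁ * centralTrinomial m
          + (get p s).a₂ * centralTrinomial (m - 1)) : ZMod (p ^ 2)) * hpp
    · linear_combination (p * m + s + 1 : ZMod (p ^ 2)) ^ 2 * h2
        + (m ^ 2 * (get p s).a₀ * centralTrinomial m
          + (2 * (s + 1) + p * m) * m ^ 2 * ((get p s).a₁ * centralTrinomial m
          + (get p s).a₂ * centralTrinomial (m - 1)) : ZMod (p ^ 2)) * hpp

/-- The value at `m` of the linear form that describes `u * T (p * m + s) + T (p * m + s + 1)`
up to a unit. -/
def combination (p s u m : ℕ) : ℕ :=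
  trinomialForm p m (u * ((s + 1) * (get p s).a₀) + (get p (s + 1)).a₀)
    (u * ((s + 1) * (get p s).a₁ + (get p s).a₀) + (get p (s + 1)).a₁)
    (u * ((s + 1) * (get p s).a₂) + (get p (s + 1)).a₂)

theorem natCast_combination (p : ℕ) [Fact p.Prime]
    (h : (centralTrinomial p : ZMod (p ^ 2)) = 1) (s u m : ℕ) :
    (combination p s u m : ZMod (p ^ 2)) = unit p m (s + 1) *
      (u * centralTrinomial (p * m + s) + centralTrinomial (p * m + s + 1)) := by
  have hpp := natCast_mul_self_eq_zero p
  have h1 := (get_spec p h m s).2.1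
  have h2 := (get_spec p h m (s + 1)).2.1
  rw [← add_assoc] at h2
  rw [combination]
  simp only [natCast_trinomialForm] at h1 h2 ⊢
  rw [unit_succ] at h2 ⊢
  push_cast at h2 ⊢
  linear_combination -h2 - (u * (p * m + s + 1) : ZMod (p ^ 2)) * h1
    - (u * m ^ 2 * ((get p s).a₁ * centralTrinomial m
          + (get p s).a₂ * centralTrinomial (m - 1)) : ZMod (p ^ 2)) * hpp

end TrinomialState

/-! ### The reflection congruence for T(pn-1) -/

/-- The number `λ = 3 ^ (p - 1)` modulo `p ^ 2` in the congruence
`T (p * n - 1) ≡ ε * λ ^ n * T (n - 1)` for the central trinomial coefficients. -/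
def reflectionScale (p : ℕ) : ℕ := 3 ^ (p - 1) % p ^ 2

/-- The sign `ε = ±1` modulo `p ^ 2` in the congruence
`T (p * n - 1) ≡ ε * λ ^ n * T (n - 1)` for the central trinomial coefficients. -/
def reflectionSign (p : ℕ) : ℕ := if p % 3 = 1 then 1 else p ^ 2 - 1

open TrinomialState

/-- A finite criterion for `T (p * n) ≡ T n` and `T (p * n - 1) ≡ ε * λ ^ n * T (n - 1)`
modulo `p ^ 2`. -/
abbrev ReflectionCriterion (p : ℕ) : Prop :=
  (trinomialPair p).1 % p ^ 2 = 1 ∧ reflectionScale p % p = 1 ∧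
  (get p (p - 1)).a₂ % p = 0 ∧
  (get p (p - 1)).a₀ % p ^ 2
    = reflectionSign p * reflectionScale p * (get p (p - 1)).d₀ % p ^ 2 ∧
  (get p (p - 1)).a₁ % p = reflectionSign p * reflectionScale p *
    ((get p (p - 1)).d₁ + reflectionScale p / p * (get p (p - 1)).d₀) % p

theorem natCast_eq_of_mod {q a b : ℕ} (h : a % q = b % q) : (a : ZMod q) = b :=
  (ZMod.natCast_eq_natCast_iff a b q).mpr h

theorem natCast_sq_sub_one {p : ℕ} (hp : 0 < p) : ((p ^ 2 - 1 : ℕ) : ZMod (p ^ 2)) = -1 := by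
  rw [Nat.cast_sub (Nat.pow_pos hp), ZMod.natCast_self]
  simp

theorem reflectionSign_mul_self {p : ℕ} (hp : 0 < p) :
    (reflectionSign p * reflectionSign p : ZMod (p ^ 2)) = 1 := by
  rw [reflectionSign]
  split_ifs
  · simp
  · rw [natCast_sq_sub_one hp]; ring

theorem reflectionScale_pow (p : ℕ) (h : reflectionScale p % p = 1) (m : ℕ) :
    (reflectionScale p : ZMod (p ^ 2)) ^ m = 1 + p * m * (reflectionScale p / p : ℕ) := by
  have hpp := natCast_mul_self_eq_zero p
  have h1 := congrArg (Nat.cast : ℕ → ZMod (p ^ 2)) (Nat.div_add_mod (reflectionScale p) p)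
  rw [h] at h1
  push_cast at h1
  induction m with
  | zero => simp
  | succ m ih =>
    rw [pow_succ (reflectionScale p : ZMod (p ^ 2)) m, ih]
    push_cast
    linear_combination -(1 + p * m * (reflectionScale p / p : ℕ) : ZMod (p ^ 2)) * h1
      + (m * (reflectionScale p / p : ℕ) ^ 2 : ZMod (p ^ 2)) * hpp

theorem reflectionScale_pow_mul (p : ℕ) (h : reflectionScale p % p = 1) (m : ℕ) :
    (reflectionScale p : ZMod (p ^ 2)) ^ (p * m) = 1 := by
  rw [reflectionScale_pow p h]
  push_cast
  linear_combination (m * (reflectionScale p / p : ℕ) : ZMod (p ^ 2)) *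
    natCast_mul_self_eq_zero p

namespace ReflectionCriterion

variable {p : ℕ} [Fact p.Prime]

theorem centralTrinomial_self (h : ReflectionCriterion p) :
    (centralTrinomial p : ZMod (p ^ 2)) = 1 := by
  have hp : p.Prime := Fact.out
  have h1 := h.1
  rw [trinomialPair_eq] at h1
  have := natCast_eq_of_mod (q := p ^ 2) (a := centralTrinomial p) (b := 1)
    (by rw [h1, Nat.mod_eq_of_lt (Nat.one_lt_pow two_ne_zero hp.one_lt)])
  simpa using this

/-- Take s = p - 1 in `get_spec` and expand λᵐ = 1 + pm·⌊λ/p⌋. Matching the coefficients of T(m),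
pm·T(m) and pm·T(m-1) gives exactly the last three conditions of the criterion. -/
theorem centralTrinomial_mul_sub_one (h : ReflectionCriterion p) (n : ℕ) (hn : 0 < n) :
    (centralTrinomial (p * n - 1) : ZMod (p ^ 2))
      = reflectionSign p * reflectionScale p ^ n * centralTrinomial (n - 1) := by
  have hp : p.Prime := Fact.out
  have hp1 : p - 1 < p := Nat.sub_lt hp.pos one_pos
  have hpp := natCast_mul_self_eq_zero p
  obtain ⟨m, rfl⟩ : ∃ m, n = m + 1 := ⟨n - 1, by omega⟩
  obtain ⟨hd, ha, -⟩ := get_spec p h.centralTrinomial_self m (p - 1)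
  have hu := isUnit_unit p hp m (p - 1) hp1
  obtain ⟨-, h2, h3, h4, h5⟩ := h
  have h3 := natCast_mul_eq_natCast_mul (p := p) (b := 0) (natCast_eq_of_mod (by simpa using h3))
  have h4 := natCast_eq_of_mod h4
  have h5 := natCast_mul_eq_natCast_mul (natCast_eq_of_mod h5)
  rw [show p * (m + 1) - 1 = p * m + (p - 1) by rw [mul_add]; have := hp.pos; omega,
    Nat.add_sub_cancel, ← hu.mul_right_inj, ha, natCast_trinomialForm, hd,
    pow_succ (reflectionScale p : ZMod (p ^ 2)) m, reflectionScale_pow p h2]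
  push_cast at h3 h4 h5 ⊢
  linear_combination (m * centralTrinomial (m - 1) : ZMod (p ^ 2)) * h3
    + (centralTrinomial m : ZMod (p ^ 2)) * h4 + (m * centralTrinomial m : ZMod (p ^ 2)) * h5
    - (reflectionSign p * reflectionScale p * m ^ 2 * (reflectionScale p / p : ℕ) *
      (get p (p - 1)).d₁ * centralTrinomial m : ZMod (p ^ 2)) * hpp

/-- The linear form `v * λ ^ n * T (n - 1) + T n` at a multiple of `p`. -/
theorem form_mul (h : ReflectionCriterion p) (v : ZMod (p ^ 2)) (n : ℕ) (hn : 0 < n) :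
    v * (reflectionScale p : ZMod (p ^ 2)) ^ (p * n) *
        (centralTrinomial (p * n - 1) : ZMod (p ^ 2)) + (centralTrinomial (p * n) : ZMod (p ^ 2))
      = v * (reflectionSign p : ZMod (p ^ 2)) * (reflectionScale p : ZMod (p ^ 2)) ^ n *
          (centralTrinomial (n - 1) : ZMod (p ^ 2)) + (centralTrinomial n : ZMod (p ^ 2)) := by
  rw [reflectionScale_pow_mul p h.2.1, h.centralTrinomial_mul_sub_one n hn,
    centralTrinomial_mul p h.centralTrinomial_self]
  ring

end ReflectionCriterion

/-! ### Zeros of Motzkin numbers modulo p² -/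

section Motzkin

variable {p : ℕ} [Fact p.Prime]

theorem isUnit_two (hp : 3 < p) : IsUnit (2 : ZMod (p ^ 2)) := by
  have := isUnit_natCast_of_not_dvd (Fact.out : p.Prime) (a := 2)
    (fun h => by have := Nat.le_of_dvd two_pos h; omega)
  simpa using this

theorem motzkin_eq_zero_iff (hp : 3 < p) (N : ℕ) (hN : ¬ p ∣ N + 2) :
    (motzkin N : ZMod (p ^ 2)) = 0 ↔
      (3 * centralTrinomial N + centralTrinomial (N + 1) : ZMod (p ^ 2)) = 0 := by
  have h := congrArg (Nat.cast : ℕ → ZMod (p ^ 2)) (two_mul_add_two_mul_motzkin N)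
  push_cast at h
  have h1 := isUnit_natCast_of_not_dvd (Fact.out : p.Prime) hN
  push_cast at h1
  rw [← h, mul_assoc, (isUnit_two hp).mul_right_eq_zero, h1.mul_right_eq_zero]

theorem motzkin_eq_zero_iff_of_dvd (hp : 3 < p) (N n : ℕ) (hN : N + 2 = p * n) :
    (motzkin N : ZMod (p ^ 2)) = 0 ↔
      (-centralTrinomial (p * n - 1) + centralTrinomial (p * n) : ZMod (p ^ 2)) = 0 := by
  have hpp := natCast_mul_self_eq_zero p
  have h1 := congrArg (Nat.cast : ℕ → ZMod (p ^ 2)) (two_mul_motzkin N)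
  have h2 := congrArg (Nat.cast : ℕ → ZMod (p ^ 2)) (centralTrinomial_rec (N + 1))
  have h3 := congrArg (Nat.cast : ℕ → ZMod (p ^ 2)) hN
  have h4 := isUnit_natCast_of_not_dvd (p := p) Fact.out (a := p * n + 1) (by
    rw [← Nat.dvd_add_iff_right (Dvd.intro _ rfl), Nat.dvd_one]; omega)
  rw [← hN, show N + 2 - 1 = N + 1 by omega]
  simp only [add_assoc, Nat.add_sub_cancel, Nat.reduceAdd] at h2
  push_cast at h1 h2 h3 h4
  have h5 : (N : ZMod (p ^ 2)) = p * n - 2 := by linear_combination h3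
  rw [h5] at h2
  rw [← (isUnit_two hp).mul_right_eq_zero, ← h4.mul_right_eq_zero (b := -_ + _)]
  -- The recurrence at N + 1 eliminates T(N): its coefficient is 3(pn - 1), and 1 - pn has inverse 1
  -- + pn modulo p².
  have h6 : (2 : ZMod (p ^ 2)) * motzkin N
      = -((p * n + 1) * (-centralTrinomial (N + 1) + centralTrinomial (N + 2))) := by
    linear_combination h1 + (1 + p * n : ZMod (p ^ 2)) * h2
      - (n ^ 2 * (centralTrinomial (N + 2) - 2 * centralTrinomial (N + 1)
        - 3 * centralTrinomial N) : ZMod (p ^ 2)) * hpp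
  rw [h6, neg_eq_zero]

namespace ReflectionCriterion

theorem motzkin_mul_sub_one_eq_zero_iff (h : ReflectionCriterion p) (hp : 3 < p) (N n : ℕ)
    (hn : 0 < n) (hN : N + 1 = p * n) :
    (motzkin N : ZMod (p ^ 2)) = 0 ↔
      (3 * reflectionSign p * reflectionScale p ^ n * centralTrinomial (n - 1)
        + centralTrinomial n : ZMod (p ^ 2)) = 0 := by
  rw [← h.form_mul 3 n hn, reflectionScale_pow_mul p h.2.1, ← hN, Nat.add_sub_cancel, mul_one,
    motzkin_eq_zero_iff hp]
  rw [show N + 2 = p * n + 1 by omega, ← Nat.dvd_add_iff_right (Dvd.intro _ rfl), Nat.dvd_one]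
  omega

theorem motzkin_mul_sub_two_eq_zero_iff (h : ReflectionCriterion p) (hp : 3 < p) (N n : ℕ)
    (hn : 0 < n) (hN : N + 2 = p * n) :
    (motzkin N : ZMod (p ^ 2)) = 0 ↔
      (-1 * reflectionSign p * reflectionScale p ^ n * centralTrinomial (n - 1)
        + centralTrinomial n : ZMod (p ^ 2)) = 0 := by
  rw [← h.form_mul (-1) n hn, reflectionScale_pow_mul p h.2.1,
    motzkin_eq_zero_iff_of_dvd hp N n hN, mul_one, neg_one_mul]

end ReflectionCriterion

/-- `u * T (p * m + s) + T (p * m + s + 1)` vanishes modulo `p ^ 2` if and only if the linear form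
describing it does. -/
theorem combination_eq_zero_iff (h : (centralTrinomial p : ZMod (p ^ 2)) = 1) (s u m : ℕ)
    (hs : s + 1 < p) :
    (combination p s u m : ZMod (p ^ 2)) = 0 ↔
      (u * centralTrinomial (p * m + s) + centralTrinomial (p * m + s + 1) : ZMod (p ^ 2)) = 0 := by
  rw [natCast_combination p h, (isUnit_unit p Fact.out m (s + 1) hs).mul_right_eq_zero]

/-- A finite criterion for `u * T (p * m + s) + T (p * m + s + 1)` not to vanish modulo `p ^ 2`
for any `m`. -/
abbrev NonvanishingCriterion (p s u : ℕ) : Prop :=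
  p ∣ u * ((s + 1) * (get p s).a₀) + (get p (s + 1)).a₀ →
    ∀ t < p, ¬ p ^ 2 ∣ combination p s u t

theorem NonvanishingCriterion.ne_zero {s u : ℕ} (h : NonvanishingCriterion p s u)
    (hT : ∀ s < p, ¬ p ∣ centralTrinomial s)
    (h1 : (centralTrinomial p : ZMod (p ^ 2)) = 1) (hs : s + 1 < p) (m : ℕ) :
    (u * centralTrinomial (p * m + s) + centralTrinomial (p * m + s + 1) : ZMod (p ^ 2)) ≠ 0 := by
  rw [ne_eq, ← combination_eq_zero_iff h1 s u m hs]
  exact trinomialForm_ne_zero p hT _ _ _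
    (fun hd t ht h0 => h hd t ht ((ZMod.natCast_eq_zero_iff _ _).mp h0)) m

/-- The forms `v * λ ^ n * T (n - 1) + T n` that govern the Motzkin numbers with indices
congruent to `-1` or `-2` modulo `p` have these coefficients `v`. -/
def boundaryCoeffs (p : ℕ) : List ℕ :=
  [3, p ^ 2 - 1, 3 * reflectionSign p, (p ^ 2 - 1) * reflectionSign p]

/-- A finite criterion for `p ^ 2` not to divide any Motzkin number. -/
abbrev MotzkinCriterion (p : ℕ) : Prop :=
  ReflectionCriterion p ∧ (∀ s < p, ¬ p ∣ (trinomialPair s).1) ∧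
  (∀ s < p - 2, NonvanishingCriterion p s 3) ∧
  ∀ s < p - 1, ∀ u ∈ boundaryCoeffs p, NonvanishingCriterion p s (u * reflectionScale p ^ (s + 1))

namespace MotzkinCriterion

theorem not_dvd {p : ℕ} (h : MotzkinCriterion p) (s : ℕ) (hs : s < p) : ¬ p ∣ centralTrinomial s := by
  have := h.2.1 s hs
  rwa [trinomialPair_eq] at this

theorem boundary_ne_zero (h : MotzkinCriterion p) (n : ℕ) (hn : 0 < n) (u : ℕ)
    (hu : u ∈ boundaryCoeffs p) :
    (u * reflectionScale p ^ n * centralTrinomial (n - 1) + centralTrinomial n : ZMod (p ^ 2))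
      ≠ 0 := by
  have hp : p.Prime := Fact.out
  induction n using Nat.strong_induction_on generalizing u with
  | _ n ih =>
    by_cases hd : p ∣ n
    · obtain ⟨n, rfl⟩ := hd
      have hn' : 0 < n := Nat.pos_of_mul_pos_left hn
      have hlt : n < p * n := lt_mul_of_one_lt_left hn' hp.one_lt
      rw [h.1.form_mul _ n hn']
      -- Since ε² = 1, the set {3, -1, 3ε, -ε} is stable under multiplication by ε, so the descent
      -- stays inside it.
      obtain ⟨w, hw, hwu⟩ : ∃ w ∈ boundaryCoeffs p,
          (w : ZMod (p ^ 2)) = u * reflectionSign p := by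
        have hss := reflectionSign_mul_self hp.pos
        simp only [boundaryCoeffs, List.mem_cons, List.not_mem_nil, or_false] at hu ⊢
        rcases hu with rfl | rfl | rfl | rfl
        · exact ⟨_, Or.inr (Or.inr (Or.inl rfl)), by push_cast; ring⟩
        · exact ⟨_, Or.inr (Or.inr (Or.inr rfl)), by push_cast; ring⟩
        · exact ⟨_, Or.inl rfl, by push_cast; linear_combination -3 * hss⟩
        · refine ⟨_, Or.inr (Or.inl rfl), ?_⟩
          rw [Nat.cast_mul]
          linear_combination -((p ^ 2 - 1 : ℕ) : ZMod (p ^ 2)) * hss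
      rw [← hwu]
      exact ih n hlt hn' w hw
    · have h0 : n % p ≠ 0 := fun h0 => hd (Nat.dvd_of_mod_eq_zero h0)
      have hlt := Nat.mod_lt n hp.pos
      obtain ⟨s, hs⟩ : ∃ s, n % p = s + 1 := ⟨n % p - 1, by omega⟩
      have hn2 : n = p * (n / p) + s + 1 := by
        rw [add_assoc, ← hs]; exact (Nat.div_add_mod n p).symm
      have := (h.2.2.2 s (by omega) u hu).ne_zero h.not_dvd h.1.centralTrinomial_self
        (by omega) (n / p)
      rw [← hn2, show p * (n / p) + s = n - 1 by omega] at this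
      -- As λ ≡ 1 mod p, λᵖ ≡ 1 mod p², so only the exponent modulo p matters.
      have hpow : (reflectionScale p : ZMod (p ^ 2)) ^ n = reflectionScale p ^ (s + 1) := by
        rw [hn2, add_assoc, pow_add, reflectionScale_pow_mul p h.1.2.1, one_mul]
      rw [hpow]
      push_cast at this
      exact this

theorem motzkin_ne_zero (h : MotzkinCriterion p) (hp3 : 3 < p) (N : ℕ) :
    (motzkin N : ZMod (p ^ 2)) ≠ 0 := by
  have hp : p.Prime := Fact.out
  have hlt := Nat.mod_lt N hp.pos
  have hN := Nat.div_add_mod N p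
  have hcast := natCast_sq_sub_one hp.pos
  by_cases h1 : N % p = p - 1
  · rw [ne_eq, h.1.motzkin_mul_sub_one_eq_zero_iff hp3 N (N / p + 1) (Nat.succ_pos _)
      (by rw [mul_add]; omega)]
    have := h.boundary_ne_zero (N / p + 1) (Nat.succ_pos _) (3 * reflectionSign p)
      (by simp [boundaryCoeffs])
    push_cast at this ⊢
    exact this
  by_cases h2 : N % p = p - 2
  · rw [ne_eq, h.1.motzkin_mul_sub_two_eq_zero_iff hp3 N (N / p + 1) (Nat.succ_pos _)
      (by rw [mul_add]; omega)]
    have := h.boundary_ne_zero (N / p + 1) (Nat.succ_pos _) ((p ^ 2 - 1) * reflectionSign p)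
      (by simp [boundaryCoeffs])
    rw [Nat.cast_mul, hcast] at this
    exact this
  · have h3 := (h.2.2.1 (N % p) (by omega)).ne_zero h.not_dvd h.1.centralTrinomial_self
      (by omega) (N / p)
    rw [hN] at h3
    rw [ne_eq, motzkin_eq_zero_iff hp3 N]
    · push_cast at h3
      exact h3
    · rw [← hN, add_assoc, ← Nat.dvd_add_iff_right (Dvd.intro _ rfl)]
      intro hd
      have := Nat.le_of_dvd (by omega) hd
      omega

end MotzkinCriterion

/-- A finite certificate for a multiple of `p ^ 2` among the Motzkin numbers: its index is
`p * t + s`, or it is `p * n - 1`, `p * n - 2` or `p ^ 2 * n - 1` with `n = p * t + s + 1`. -/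
abbrev MotzkinWitness (p t s : ℕ) : Prop :=
  3 < p ∧ ReflectionCriterion p ∧ s + 1 < p ∧
  ((s + 2 < p ∧ p ^ 2 ∣ combination p s 3 t) ∨
    p ^ 2 ∣ combination p s (3 * reflectionSign p * reflectionScale p ^ (s + 1)) t ∨
    p ^ 2 ∣ combination p s ((p ^ 2 - 1) * reflectionSign p * reflectionScale p ^ (s + 1)) t ∨
    p ^ 2 ∣ combination p s (3 * reflectionScale p ^ (s + 1)) t)

theorem MotzkinWitness.exists_dvd {t s : ℕ} (h : MotzkinWitness p t s) :
    ∃ n, p ^ 2 ∣ motzkin n := by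
  have hp : p.Prime := Fact.out
  obtain ⟨hp3, hR, hs, h⟩ := h
  have hT := hR.centralTrinomial_self
  have hpow : (reflectionScale p : ZMod (p ^ 2)) ^ (p * t + s + 1) = reflectionScale p ^ (s + 1) := by
    rw [add_assoc, pow_add, reflectionScale_pow_mul p hR.2.1, one_mul]
  have hn : 0 < p * t + s + 1 := Nat.succ_pos _
  have hpn : ∀ n, 0 < n → p ≤ p * n := fun n hn => Nat.le_mul_of_pos_right p hn
  simp only [← ZMod.natCast_eq_zero_iff] at h ⊢
  simp only [combination_eq_zero_iff hT s _ t hs] at h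
  rcases h with ⟨h2, h⟩ | h | h | h
  · refine ⟨p * t + s, (motzkin_eq_zero_iff hp3 _ ?_).mpr (by exact_mod_cast h)⟩
    rw [add_assoc, ← Nat.dvd_add_iff_right (Dvd.intro _ rfl)]
    intro hd
    have := Nat.le_of_dvd (by omega) hd
    omega
  · refine ⟨p * (p * t + s + 1) - 1, (hR.motzkin_mul_sub_one_eq_zero_iff hp3 _ _ hn ?_).mpr ?_⟩
    · have := hpn _ hn; omega
    · rw [hpow, Nat.add_sub_cancel]
      exact_mod_cast h
  · refine ⟨p * (p * t + s + 1) - 2, (hR.motzkin_mul_sub_two_eq_zero_iff hp3 _ _ hn ?_).mpr ?_⟩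
    · have := hpn _ hn; omega
    · rw [Nat.cast_mul, Nat.cast_mul, natCast_sq_sub_one hp.pos] at h
      rw [hpow, Nat.add_sub_cancel]
      exact_mod_cast h
  -- Two boundary reductions are applied in succession, and the two signs ε cancel.
  · have hn' : 0 < p * (p * t + s + 1) := Nat.mul_pos hp.pos hn
    refine ⟨p * (p * (p * t + s + 1)) - 1,
      (hR.motzkin_mul_sub_one_eq_zero_iff hp3 _ _ hn' ?_).mpr ?_⟩
    · have := hpn _ hn'; omega
    · rw [hR.form_mul _ _ hn, mul_assoc (3 : ZMod (p ^ 2)), reflectionSign_mul_self hp.pos, mul_one,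
        hpow, Nat.add_sub_cancel]
      exact_mod_cast h

end Motzkin

/-! ### Numerical certificates and conclusion -/

theorem motzkin_three : motzkin 3 = 4 := by
  have h := two_mul_add_two_mul_motzkin 3
  rw [show centralTrinomial 3 = 7 by decide, show centralTrinomial (3 + 1) = 19 by decide] at h
  omega

theorem motzkin_four : motzkin 4 = 9 := by
  have h := two_mul_add_two_mul_motzkin 4
  rw [show centralTrinomial 4 = 19 by decide, show centralTrinomial (4 + 1) = 51 by decide] at h
  omega

/-- Parameters `(p, t, s)` of certificates for the primes `3 < p < 200` whose square divides a
Motzkin number. -/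
def motzkinWitnesses : List (ℕ × ℕ × ℕ) :=
  [(7, 3, 2), (11, 0, 1), (17, 11, 1), (19, 3, 8), (23, 1, 20), (29, 2, 18), (41, 32, 14),
    (43, 9, 2), (47, 23, 11), (53, 4, 36), (59, 24, 34), (67, 9, 0), (71, 16, 68), (73, 9, 8),
    (83, 8, 81), (89, 3, 66), (101, 40, 1), (107, 28, 76), (109, 61, 53), (113, 12, 37),
    (127, 45, 117), (131, 7, 18), (137, 7, 112), (139, 4, 0), (149, 13, 23), (151, 34, 0),
    (157, 20, 0), (163, 25, 110), (167, 63, 164), (173, 61, 79), (179, 44, 59), (181, 22, 122),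
    (191, 70, 48), (193, 49, 0), (197, 45, 1), (199, 61, 37)]

set_option maxRecDepth 10000 in
theorem motzkinWitness_of_mem :
    ∀ w ∈ motzkinWitnesses, MotzkinWitness w.1 w.2.1 w.2.2 := by
  decide +kernel

-- The bound 15 suffices because 15² > 200: a composite below 200 has a divisor between 2 and 14.
set_option maxRecDepth 10000 in
theorem exists_mem_motzkinWitnesses_or : ∀ p < 200, p < 2 ∨ (∃ d < 15, 2 ≤ d ∧ d ∣ p ∧ d ≠ p) ∨
    p ∈ [2, 3, 5, 13, 31, 37, 61, 79, 97, 103] ∨ ∃ w ∈ motzkinWitnesses, w.1 = p := by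
  decide +kernel

theorem exists_mem_motzkinWitnesses (p : ℕ) (hp : p.Prime) (hlt : p < 200)
    (h : p ∉ [2, 3, 5, 13, 31, 37, 61, 79, 97, 103]) : ∃ w ∈ motzkinWitnesses, w.1 = p := by
  rcases exists_mem_motzkinWitnesses_or p hlt with h1 | ⟨d, -, h2, hd, hne⟩ | h1 | h1
  · exact absurd hp.two_le (by omega)
  · rcases hp.eq_one_or_self_of_dvd d hd with h3 | h3
    · omega
    · exact absurd h3 hne
  · exact absurd h1 h
  · exact h1

set_option maxRecDepth 10000 in
theorem motzkinCriterion_of_mem :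
    ∀ p ∈ [5, 13, 31, 37, 61, 79, 97, 103], 3 < p ∧ MotzkinCriterion p := by
  decide +kernel

theorem theorem3p3 :
    (∀ p ∈ ({5, 13, 31, 37, 61, 79, 97, 103} : Set ℕ),
      ∀ n : ℕ, ¬ motzkin n ≡ 0 [MOD p ^ 2]) ∧
    (∀ p : ℕ, p.Prime → p < 200 → p ∉ ({5, 13, 31, 37, 61, 79, 97, 103} : Set ℕ) →
      ∃ n : ℕ, p ^ 2 ∣ motzkin n) := by
  constructor
  · intro p hp n h
    obtain ⟨h3, hc⟩ := motzkinCriterion_of_mem p (by simpa using hp)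
    have : Fact p.Prime := ⟨by rcases hp with rfl | rfl | rfl | rfl | rfl | rfl | rfl | rfl <;>
      norm_num⟩
    exact hc.motzkin_ne_zero h3 n
      ((ZMod.natCast_eq_zero_iff _ _).mpr ((Nat.modEq_zero_iff_dvd).mp h))
  · intro p hprime hlt hp
    have : Fact p.Prime := ⟨hprime⟩
    by_cases h2 : p = 2
    · exact ⟨3, by rw [motzkin_three, h2]; norm_num⟩
    by_cases h3 : p = 3
    · exact ⟨4, by rw [motzkin_four, h3]; norm_num⟩
    obtain ⟨⟨p', t, s⟩, hw, rfl⟩ := exists_mem_motzkinWitnesses p hprime hlt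
      (by simpa [h2, h3] using hp)
    exact (motzkinWitness_of_mem _ hw).exists_dvd
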